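/- Let $p$ be a prime, let $\mathbb{Z}_p$ be the ring of $p$-adic integers and let $r \in \mathbb{Z}_p^\times$ be a unit that is not a root of unity. For $0\neq s\in\mathbb{Z}_p$ let $\alpha_s$ be the endomorphism of $C(\mathbb{Z}_p)$ (complex-valued continuous functions) given by $(\alpha_s f)(x) = f(x/s)$ if $s \mid x$ and $(\alpha_s f)(x) = 0$ otherwise, and let $A_s = C(\mathbb{Z}_p)\rtimes_{\alpha_s}\mathbb{N}$ be the universal unital C$^*$-algebra generated by a copy $\{M_f : f \in C(\mathbb{Z}_p)\}$ of $C(\mathbb{Z}_p)$ (with $M_1 = I$) and an element $V_s$ subject to the relations $$V_s^*V_s = I, \qquad V_s M_f V_s^* = M_{\alpha_s(f)} \quad (f \in C(\mathbb{Z}_p)).$$ Let $G_r = \overline{\{r^k : k \in \mathbb{Z}\}}$ be the closed subgroup of $\mathbb{Z}_p^\times$ generated by $r$, and let $\gamma : \mathbb{Z}_p^\times/G_r \to \mathbb{Z}_p^\times$ be any (set-theoretic) section of the quotient map $\mathbb{Z}_p^\times \to \mathbb{Z}_p^\times/G_r$. Then there is a faithful (that is, injective) unital $*$-representation $$\pi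 : A_r \to B\big(\ell^2(\mathbb{Z}\times\mathbb{Z}_{\ge 0}\times \mathbb{Z}_p^\times/G_r)\big)$$ such that, for all $\phi$ in this Hilbert space, all $k \in \mathbb{Z}$, $L \in \mathbb{Z}_{\ge 0}$, $xG_r \in \mathbb{Z}_p^\times/G_r$ and all $f \in C(\mathbb{Z}_p)$, $$(\pi(V_r)\phi)(k, L, xG_r) = \phi(k-1, L, xG_r), \qquad (\pi(M_f)\phi)(k,L,xG_r) = f\big(r^k p^L \gamma(xG_r)\big)\,\phi(k,L,xG_r).$$ -/

import Mathlib

open scoped ENNReal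

noncomputable section

universe u

/-- A covariant pair for a star-endomorphism `α` (not necessarily unital) of a unital C*-algebra
`B`, with values in a nonzero unital C*-algebra: a unital star-homomorphism `M` on `B` and an
isometry `V` with `V M(b) V* = M(α b)`. (The zero algebra carries exactly one such pair, which
contributes nothing to a direct sum of pairs.) -/
structure CovariantPair (B : Type u) [CStarAlgebra B] (α : B →⋆ₙₐ[ℂ] B) where
  /-- the C*-algebra in which the pair lives -/
  Carrier : Type u
  [cstar : CStarAlgebra Carrier]
  [nontriv : Nontrivial Carrier]
  /-- the representation of the coefficient algebra -/
  M : B →⋆ₐ[ℂ] Carrier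
  /-- the isometry -/
  V : Carrier
  isometry : star V * V = 1
  covariance : ∀ b, V * M b * star V = M (α b)

attribute [instance] CovariantPair.cstar CovariantPair.nontriv

namespace StaceyCrossedProduct

variable (B : Type u) [CStarAlgebra B] (α : B →⋆ₙₐ[ℂ] B)

/-- The C*-algebra of all bounded families `(a_c)`, one entry for each covariant pair `c`, with
entrywise operations and the supremum norm. -/
abbrev Families : Type (u + 1) :=
  lp (fun c : CovariantPair B α => c.Carrier) ∞

instance : CStarAlgebra (Families B α) where

variable {B}

/-- The family `(M_c(b))_c`. -/
def familyM (b : B) : Families B α :=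
  ⟨fun c => c.M b, memℓp_infty ⟨‖b‖, by
    rintro _ ⟨c, rfl⟩
    exact NonUnitalStarAlgHom.norm_apply_le c.M b⟩⟩

/-- The family `(V_c)_c`. -/
def familyV : Families B α :=
  ⟨fun c => c.V, memℓp_infty ⟨1, by
    rintro _ ⟨c, rfl⟩
    have h : ‖c.V‖ * ‖c.V‖ = 1 := by
      rw [← CStarRing.norm_star_mul_self, c.isometry, CStarRing.norm_one]
    show ‖c.V‖ ≤ 1
    nlinarith [norm_nonneg c.V]⟩⟩

/-- The unital C*-subalgebra generated by the families `(M_c(b))_c` and `(V_c)_c`. -/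
def subalgebra : StarSubalgebra ℂ (Families B α) :=
  (StarAlgebra.adjoin ℂ (Set.range (familyM α) ∪ {familyV α})).topologicalClosure

instance : IsClosed (subalgebra α : Set (Families B α)) :=
  StarSubalgebra.isClosed_topologicalClosure _

end StaceyCrossedProduct

/-- The crossed product `B ⋊_α ℕ` of a unital C*-algebra `B` by a star-endomorphism `α` (in the
sense of Stacey): the universal unital C*-algebra generated by a copy `M` of `B` and an isometry
`V` subject to `V M(b) V* = M(α b)`. It is realised as the C*-algebra generated by the direct sum
of all covariant pairs; see `StaceyCrossedProduct.existsUnique_lift` for the universal property.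
(A C*-algebra generated by the image of `B` and one further element is isomorphic to one in the
universe of `B`, so pairs in that universe suffice.) -/
abbrev StaceyCrossedProduct (B : Type u) [CStarAlgebra B] (α : B →⋆ₙₐ[ℂ] B) : Type (u + 1) :=
  StaceyCrossedProduct.subalgebra α

namespace StaceyCrossedProduct

variable {B : Type u} [CStarAlgebra B] (α : B →⋆ₙₐ[ℂ] B)

/-- The generators `M_b`, `b ∈ B`. -/
def M : B →⋆ₐ[ℂ] StaceyCrossedProduct B α where
  toFun b := ⟨familyM α b, StarSubalgebra.le_topologicalClosure _
    (StarAlgebra.subset_adjoin ℂ _ (Or.inl ⟨b, rfl⟩))⟩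
  map_one' := Subtype.ext (lp.ext (funext fun c => map_one c.M))
  map_mul' a b := Subtype.ext (lp.ext (funext fun c => map_mul c.M a b))
  map_zero' := Subtype.ext (lp.ext (funext fun c => map_zero c.M))
  map_add' a b := Subtype.ext (lp.ext (funext fun c => map_add c.M a b))
  commutes' z := Subtype.ext (lp.ext (funext fun c => AlgHomClass.commutes c.M z))
  map_star' b := Subtype.ext (lp.ext (funext fun c => map_star c.M b))

/-- The generating isometry `V`. -/
def V : StaceyCrossedProduct B α :=
  ⟨familyV α, StarSubalgebra.le_topologicalClosure _
    (StarAlgebra.subset_adjoin ℂ _ (Or.inr rfl))⟩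

theorem star_V_mul_V : star (V α) * V α = 1 :=
  Subtype.ext (lp.ext (funext fun c => c.isometry))

theorem V_mul_M_mul_star_V (b : B) : V α * M α b * star (V α) = M α (α b) :=
  Subtype.ext (lp.ext (funext fun c => c.covariance b))

/-- Evaluation at one covariant pair. -/
def eval (c : CovariantPair B α) : StaceyCrossedProduct B α →⋆ₐ[ℂ] c.Carrier where
  toFun a := (a : Families B α) c
  map_one' := rfl
  map_mul' _ _ := rfl
  map_zero' := rfl
  map_add' _ _ := rfl
  commutes' _ := rfl
  map_star' _ := rfl

/-- The universal property of the crossed product. -/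
theorem existsUnique_lift {A : Type u} [CStarAlgebra A] (m : B →⋆ₐ[ℂ] A) (w : A)
    (hw : star w * w = 1) (hm : ∀ b, w * m b * star w = m (α b)) :
    ∃! φ : StaceyCrossedProduct B α →⋆ₐ[ℂ] A, φ (V α) = w ∧ ∀ b, φ (M α b) = m b := by
  refine existsUnique_of_exists_of_unique ?_ ?_
  · rcases subsingleton_or_nontrivial A with h | h
    · refine ⟨{ toFun := fun _ => 0
                map_one' := Subsingleton.elim _ _
                map_mul' := ?_
                map_zero' := rfl
                map_add' := ?_
                commutes' := ?_
                map_star' := ?_ },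
        Subsingleton.elim _ _, fun _ => Subsingleton.elim _ _⟩ <;>
      intros <;> exact Subsingleton.elim _ _
    · exact ⟨eval α ⟨A, m, w, hw, hm⟩, rfl, fun _ => rfl⟩
  · rintro φ ψ ⟨hφV, hφM⟩ ⟨hψV, hψM⟩
    have hφ : Continuous φ :=
      AddMonoidHomClass.continuous_of_bound φ 1 fun a => by
        simpa using NonUnitalStarAlgHom.norm_apply_le φ a
    have hψ : Continuous ψ :=
      AddMonoidHomClass.continuous_of_bound ψ 1 fun a => by
        simpa using NonUnitalStarAlgHom.norm_apply_le ψ a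
    refine StarAlgHom.ext_topologicalClosure hφ hψ ?_
    refine StarAlgHom.ext_adjoin fun x hx => ?_
    rcases x with ⟨x, hx'⟩
    rcases hx with ⟨b, rfl⟩ | hx
    · exact (hφM b).trans (hψM b).symm
    · obtain rfl : x = familyV α := hx
      exact hφV.trans hψV.symm

end StaceyCrossedProduct

section PadicMultiplication

variable {p : ℕ} [Fact p.Prime]

/-- For `r ≠ 0`, the function `x ↦ f (x / r)` if `r ∣ x`, and `0` otherwise. -/
def padicAlphaFun (r : ℤ_[p]) (f : C(ℤ_[p], ℂ)) (x : ℤ_[p]) : ℂ :=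
  open Classical in if h : r ∣ x then f h.choose else 0

theorem padicAlphaFun_mul {r : ℤ_[p]} (hr : r ≠ 0) (f : C(ℤ_[p], ℂ)) (y : ℤ_[p]) :
    padicAlphaFun r f (r * y) = f y := by
  have h : r ∣ r * y := dvd_mul_right r y
  rw [padicAlphaFun, dif_pos h]
  exact congrArg f (mul_left_cancel₀ hr h.choose_spec).symm

theorem padicAlphaFun_of_not_dvd {r x : ℤ_[p]} (h : ¬ r ∣ x) (f : C(ℤ_[p], ℂ)) :
    padicAlphaFun r f x = 0 := dif_neg h

theorem continuous_padicAlphaFun {r : ℤ_[p]} (hr : r ≠ 0) (f : C(ℤ_[p], ℂ)) :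
    Continuous (padicAlphaFun r f) := by
  have hdvd : ∀ x : ℤ_[p], r ∣ x ↔ ‖x‖ ≤ ‖r‖ := by
    intro x
    constructor
    · rintro ⟨y, rfl⟩
      rw [norm_mul]
      exact mul_le_of_le_one_right (norm_nonneg r) y.norm_le_one
    · intro h
      have hr' : (r : ℚ_[p]) ≠ 0 := fun h0 => hr (Subtype.ext h0)
      have hn : 0 < ‖(r : ℚ_[p])‖ := norm_pos_iff.2 hr'
      refine ⟨⟨(x : ℚ_[p]) / r, ?_⟩, ?_⟩
      · rw [norm_div]
        exact (div_le_one hn).2 h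
      · apply Subtype.ext
        show (x : ℚ_[p]) = r * (x / r)
        field_simp
  have hset : {x : ℤ_[p] | r ∣ x} = Metric.closedBall 0 ‖r‖ := by
    ext x
    simp [hdvd]
  have hclopen : IsClopen {x : ℤ_[p] | r ∣ x} := by
    rw [hset]
    exact IsUltrametricDist.isClopen_closedBall _ (norm_ne_zero_iff.2 hr)
  have hemb : Topology.IsOpenEmbedding fun y : ℤ_[p] => r * y := by
    have hc : Topology.IsClosedEmbedding fun y : ℤ_[p] => r * y :=
      (continuous_const.mul continuous_id).isClosedEmbedding (mul_right_injective₀ hr)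
    refine ⟨hc.isEmbedding, ?_⟩
    have : Set.range (fun y : ℤ_[p] => r * y) = {x | r ∣ x} := by
      ext x
      exact ⟨fun ⟨y, hy⟩ => ⟨y, hy.symm⟩, fun ⟨y, hy⟩ => ⟨y, hy.symm⟩⟩
    rw [this]
    exact hclopen.isOpen
  rw [continuous_iff_continuousAt]
  intro x
  by_cases h : r ∣ x
  · obtain ⟨y, rfl⟩ := h
    refine hemb.continuousAt_iff.1 ?_
    have : padicAlphaFun r f ∘ (fun y => r * y) = f := funext (padicAlphaFun_mul hr f)
    rw [this]
    exact f.continuous.continuousAt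
  · refine (continuousAt_const (y := (0 : ℂ))).congr ?_
    filter_upwards [hclopen.compl.isOpen.mem_nhds h] with z hz
    exact (padicAlphaFun_of_not_dvd hz f).symm

/-- The endomorphism `α_r` of `C(ℤ_p)`, for `r ≠ 0`: `(α_r f)(x) = f (x / r)` if `r ∣ x`, and
`(α_r f)(x) = 0` otherwise. -/
def padicAlpha (r : ℤ_[p]) (hr : r ≠ 0) : C(ℤ_[p], ℂ) →⋆ₙₐ[ℂ] C(ℤ_[p], ℂ) where
  toFun f := ⟨padicAlphaFun r f, continuous_padicAlphaFun hr f⟩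
  map_smul' c f := by
    ext x
    by_cases h : r ∣ x
    · obtain ⟨y, rfl⟩ := h
      simp [padicAlphaFun_mul hr]
    · simp [padicAlphaFun_of_not_dvd h]
  map_zero' := by
    ext x
    by_cases h : r ∣ x
    · obtain ⟨y, rfl⟩ := h
      simp [padicAlphaFun_mul hr]
    · simp [padicAlphaFun_of_not_dvd h]
  map_add' f g := by
    ext x
    by_cases h : r ∣ x
    · obtain ⟨y, rfl⟩ := h
      simp [padicAlphaFun_mul hr]
    · simp [padicAlphaFun_of_not_dvd h]
  map_mul' f g := by
    ext x
    by_cases h : r ∣ x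
    · obtain ⟨y, rfl⟩ := h
      simp [padicAlphaFun_mul hr]
    · simp [padicAlphaFun_of_not_dvd h]
  map_star' f := by
    ext x
    by_cases h : r ∣ x
    · obtain ⟨y, rfl⟩ := h
      simp [padicAlphaFun_mul hr]
    · simp [padicAlphaFun_of_not_dvd h]

theorem padicAlpha_unit (r : ℤ_[p]ˣ) (f : C(ℤ_[p], ℂ)) (x : ℤ_[p]) :
    padicAlpha (r : ℤ_[p]) r.ne_zero f x = f ((r⁻¹ : ℤ_[p]ˣ) * x) := by
  have h := padicAlphaFun_mul r.ne_zero f ((r⁻¹ : ℤ_[p]ˣ) * x)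
  rwa [Units.mul_inv_cancel_left] at h

/-- The C*-algebra `A_r = C(ℤ_p) ⋊_{α_r} ℕ`. -/
abbrev PadicCrossedProduct (r : ℤ_[p]) (hr : r ≠ 0) : Type 1 :=
  StaceyCrossedProduct C(ℤ_[p], ℂ) (padicAlpha r hr)

/-- The closed subgroup `G_r` of `ℤ_pˣ` generated by `r`. -/
def padicG (r : ℤ_[p]ˣ) : Subgroup ℤ_[p]ˣ :=
  (Subgroup.zpowers r).topologicalClosure

/-- The Hilbert space `ℓ²(ℤ × ℤ_{≥ 0} × ℤ_pˣ / G_r)`. -/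
abbrev padicSpace (r : ℤ_[p]ˣ) : Type :=
  lp (fun _ : ℤ × ℕ × (ℤ_[p]ˣ ⧸ padicG r) => ℂ) 2

end PadicMultiplication

end

/-! ### Laurent polynomials in the crossed product by a surjective endomorphism. -/

namespace StaceyCrossedProduct

open MeasureTheory

variable {B : Type u} [CStarAlgebra B] {α : B →⋆ₙₐ[ℂ] B}

/-! Because `r` is a unit, `α_r` is surjective, so `V` is unitary and the finite sums `∑ M (F n) V ^
n` are dense. The shift and the diagonal operators form a covariant pair, and the universal property
yields `π`; the point is injectivity.

In this representation the entry of `π (∑ M (F m) V ^ m)` from index `(k - n, L, x)` to `(k, L, x)`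
is the value of `F n` at `r ^ k p ^ L γ(x)`, since the `ℤ` coordinate separates the powers of `V`.
These points are dense in `ℤ_p`, so `π` dominates every coefficient in norm
(`norm_le_norm_map_laurent`).

Such a bound forces injectivity (`injective_of_norm_coeff_le`). If `π a = 0`, Laurent polynomials
close to `a` have small coefficients. Rotating `V` by a circle element and applying a functional
turns `a` into a continuous function on the circle, whose Fourier coefficients are controlled by
those of the approximants and therefore vanish. The function is then zero, and its value at the
identity shows that `a` vanishes in every covariant pair. -/

theorem map_one_of_surjective (hα : Function.Surjective α) : α 1 = 1 := by
  obtain ⟨b, hb⟩ := hα 1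
  calc α 1 = α 1 * α b := by rw [hb, mul_one]
    _ = 1 := by rw [← map_mul, one_mul, hb]

/-- When `α` is surjective, the generating isometry is a unitary. -/
noncomputable def unitaryV (hα : Function.Surjective α) : unitary (StaceyCrossedProduct B α) :=
  ⟨V α, star_V_mul_V α, by
    have h := V_mul_M_mul_star_V α 1
    rwa [map_one_of_surjective hα, map_one, mul_one] at h⟩

@[simp]
theorem coe_unitaryV (hα : Function.Surjective α) : (unitaryV hα : StaceyCrossedProduct B α) = V α :=
  rfl

theorem V_mul_M (b : B) : V α * M α b = M α (α b) * V α := by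
  rw [← V_mul_M_mul_star_V, mul_assoc, star_V_mul_V, mul_one]

theorem star_V_mul_M (b : B) :
    star (V α) * M α (α b) = M α b * star (V α) := by
  rw [← V_mul_M_mul_star_V, ← mul_assoc, ← mul_assoc, star_V_mul_V, one_mul]

/-- Moving `V` to the right past a coefficient applies `α`; moving `star V` past it requires a
preimage under `α`, which is where surjectivity enters. This makes the Laurent polynomials closed
under products and adjoints. -/
theorem exists_zpow_mul_M (hα : Function.Surjective α) (n : ℤ) (b : B) :
    ∃ b' : B, ((unitaryV hα ^ n : unitary _) : StaceyCrossedProduct B α) * M α b =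
      M α b' * ((unitaryV hα ^ n : unitary _) : StaceyCrossedProduct B α) := by
  induction n generalizing b with
  | zero => exact ⟨b, by simp⟩
  | succ n ih =>
    obtain ⟨b', hb'⟩ := ih (α b)
    refine ⟨b', ?_⟩
    rw [zpow_add_one, Submonoid.coe_mul, coe_unitaryV, mul_assoc, V_mul_M, ← mul_assoc, hb',
      mul_assoc]
  | pred n ih =>
    obtain ⟨c, rfl⟩ := hα b
    obtain ⟨b', hb'⟩ := ih c
    refine ⟨b', ?_⟩
    rw [zpow_sub_one, Submonoid.coe_mul, ← Unitary.star_eq_inv, Unitary.coe_star, coe_unitaryV,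
      mul_assoc, star_V_mul_M, ← mul_assoc, hb', mul_assoc]

/-- The Laurent polynomial `∑ n, M (F n) V ^ n`. -/
noncomputable def laurent (hα : Function.Surjective α) (F : ℤ →₀ B) : StaceyCrossedProduct B α :=
  F.sum fun n b => M α b * ((unitaryV hα ^ n : unitary _) : StaceyCrossedProduct B α)

theorem laurent_single (hα : Function.Surjective α) (n : ℤ) (b : B) :
    laurent hα (Finsupp.single n b) =
      M α b * ((unitaryV hα ^ n : unitary _) : StaceyCrossedProduct B α) := by
  simp [laurent]

theorem laurent_add (hα : Function.Surjective α) (F G : ℤ →₀ B) :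
    laurent hα (F + G) = laurent hα F + laurent hα G :=
  Finsupp.sum_add_index' (by simp) (by simp [add_mul])

theorem exists_laurent_mul (hα : Function.Surjective α) (F G : ℤ →₀ B) :
    ∃ H, laurent hα H = laurent hα F * laurent hα G := by
  induction F using Finsupp.induction_linear with
  | zero => exact ⟨0, by simp [laurent]⟩
  | add F₁ F₂ h₁ h₂ =>
    obtain ⟨H₁, h₁⟩ := h₁
    obtain ⟨H₂, h₂⟩ := h₂
    exact ⟨H₁ + H₂, by rw [laurent_add, laurent_add, h₁, h₂, add_mul]⟩
  | single n b =>
    induction G using Finsupp.induction_linear with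
    | zero => exact ⟨0, by simp [laurent]⟩
    | add G₁ G₂ h₁ h₂ =>
      obtain ⟨H₁, h₁⟩ := h₁
      obtain ⟨H₂, h₂⟩ := h₂
      exact ⟨H₁ + H₂, by rw [laurent_add, laurent_add, h₁, h₂, mul_add]⟩
    | single m c =>
      obtain ⟨c', hc'⟩ := exists_zpow_mul_M hα n c
      refine ⟨Finsupp.single (n + m) (b * c'), ?_⟩
      simp only [laurent_single, zpow_add, Submonoid.coe_mul, map_mul]
      rw [← mul_assoc, mul_assoc (M α b) (M α c'), ← hc']
      simp only [mul_assoc]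

theorem exists_laurent_star (hα : Function.Surjective α) (F : ℤ →₀ B) :
    ∃ H, laurent hα H = star (laurent hα F) := by
  induction F using Finsupp.induction_linear with
  | zero => exact ⟨0, by simp [laurent]⟩
  | add F₁ F₂ h₁ h₂ =>
    obtain ⟨H₁, h₁⟩ := h₁
    obtain ⟨H₂, h₂⟩ := h₂
    exact ⟨H₁ + H₂, by rw [laurent_add, laurent_add, h₁, h₂, star_add]⟩
  | single n b =>
    obtain ⟨c, hc⟩ := exists_zpow_mul_M hα (-n) (star b)
    refine ⟨Finsupp.single (-n) c, ?_⟩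
    rw [laurent_single, laurent_single, ← hc, star_mul, map_star, zpow_neg,
      ← Unitary.star_eq_inv, Unitary.coe_star]

/-- The Laurent polynomials are dense. -/
theorem exists_norm_sub_laurent_lt (hα : Function.Surjective α) (a : StaceyCrossedProduct B α)
    {ε : ℝ} (hε : 0 < ε) : ∃ F, ‖a - laurent hα F‖ < ε := by
  obtain ⟨a, ha⟩ := a
  have hadj : ∀ x ∈ StarAlgebra.adjoin ℂ (Set.range (familyM α) ∪ {familyV α}),
      ∃ F, (laurent hα F : Families B α) = x := by
    intro x hx
    induction hx using StarAlgebra.adjoin_induction with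
    | mem x hx =>
      rcases hx with ⟨b, rfl⟩ | rfl
      · exact ⟨Finsupp.single 0 b, by rw [laurent_single]; simp; rfl⟩
      · exact ⟨Finsupp.single 1 1, by rw [laurent_single]; simp; rfl⟩
    | algebraMap z =>
      refine ⟨Finsupp.single 0 (algebraMap ℂ B z), ?_⟩
      rw [laurent_single, AlgHomClass.commutes]
      simp
    | add x y _ _ hx hy =>
      obtain ⟨F, rfl⟩ := hx
      obtain ⟨G, rfl⟩ := hy
      exact ⟨F + G, by rw [laurent_add]; rfl⟩
    | mul x y _ _ hx hy =>
      obtain ⟨F, rfl⟩ := hx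
      obtain ⟨G, rfl⟩ := hy
      obtain ⟨H, hH⟩ := exists_laurent_mul hα F G
      exact ⟨H, by rw [hH]; rfl⟩
    | star x _ hx =>
      obtain ⟨F, rfl⟩ := hx
      obtain ⟨H, hH⟩ := exists_laurent_star hα F
      exact ⟨H, by rw [hH]; rfl⟩
  have ha' := ha
  rw [subalgebra, ← SetLike.mem_coe, StarSubalgebra.topologicalClosure_coe,
    Metric.mem_closure_iff] at ha'
  obtain ⟨x, hx, hax⟩ := ha' ε hε
  obtain ⟨F, rfl⟩ := hadj x hx
  rw [dist_eq_norm] at hax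
  exact ⟨F, hax⟩

/-! ### The gauge action, its Fourier coefficients and the injectivity criterion. -/

/-- The covariant pair `(M, z V)` obtained from `(M, V)` by the gauge action. -/
def _root_.CovariantPair.twist (c : CovariantPair B α) (z : Circle) : CovariantPair B α where
  Carrier := c.Carrier
  M := c.M
  V := (z : ℂ) • c.V
  isometry := by
    rw [star_smul, smul_mul_smul_comm, c.isometry, Complex.star_def, ← Circle.coe_inv_eq_conj,
      ← Circle.coe_mul, inv_mul_cancel, Circle.coe_one, one_smul]
  covariance b := by
    rw [star_smul, smul_mul_assoc, smul_mul_smul_comm, c.covariance, Complex.star_def,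
      ← Circle.coe_inv_eq_conj, ← Circle.coe_mul, mul_inv_cancel, Circle.coe_one, one_smul]

/-- The evaluation of `a` at the pair `c` twisted by `z`, as an element of the carrier of `c`. -/
noncomputable def gaugeEval (c : CovariantPair B α) (z : Circle) :
    StaceyCrossedProduct B α →⋆ₐ[ℂ] c.Carrier :=
  eval α (c.twist z)

theorem gaugeEval_one (c : CovariantPair B α) (a : StaceyCrossedProduct B α) :
    gaugeEval c 1 a = eval α c a := by
  have h : c.twist 1 = c := by
    cases c
    simp [CovariantPair.twist]
  -- The type of `eval α d a` depends on `d`, so the equality of pairs is transported through `HEq`.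
  have key : ∀ d : CovariantPair B α, d = c → HEq (eval α d a) (eval α c a) := by
    rintro d rfl
    rfl
  exact eq_of_heq (key _ h)

theorem gaugeEval_zpow (hα : Function.Surjective α) (c : CovariantPair B α) (z : Circle) (n : ℤ) :
    gaugeEval c z ((unitaryV hα ^ n : unitary _) : StaceyCrossedProduct B α) =
      ((z ^ n : Circle) : ℂ) •
        eval α c ((unitaryV hα ^ n : unitary _) : StaceyCrossedProduct B α) := by
  have hV : gaugeEval c z (V α) = (z : ℂ) • eval α c (V α) := rfl
  induction n with
  | zero => simp
  | succ n ih =>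
    rw [zpow_add_one, Submonoid.coe_mul, coe_unitaryV, map_mul, map_mul, ih, hV,
      smul_mul_smul_comm, zpow_add_one, Circle.coe_mul]
  | pred n ih =>
    rw [zpow_sub_one, Submonoid.coe_mul, ← Unitary.star_eq_inv, Unitary.coe_star, coe_unitaryV,
      map_mul, map_mul, ih, map_star, map_star, hV, star_smul, smul_mul_smul_comm, zpow_sub_one,
      Circle.coe_mul, Circle.coe_inv_eq_conj, Complex.star_def]

theorem gaugeEval_laurent (hα : Function.Surjective α) (c : CovariantPair B α) (z : Circle)
    (F : ℤ →₀ B) :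
    gaugeEval c z (laurent hα F) = ∑ n ∈ F.support, ((z ^ n : Circle) : ℂ) •
      (c.M (F n) * eval α c ((unitaryV hα ^ n : unitary _) : StaceyCrossedProduct B α)) := by
  have hM : ∀ b, gaugeEval c z (M α b) = c.M b := fun _ => rfl
  simp only [laurent, Finsupp.sum, map_sum, map_mul, gaugeEval_zpow, hM, mul_smul_comm]

theorem norm_gaugeEval_le (c : CovariantPair B α) (z : Circle) (a : StaceyCrossedProduct B α) :
    ‖gaugeEval c z a‖ ≤ ‖a‖ :=
  NonUnitalStarAlgHom.norm_apply_le (gaugeEval c z) a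

/-- Laurent polynomials give trigonometric polynomials in `z`, and each `gaugeEval c z` is
contractive, so density makes the map a uniform limit of continuous ones. -/
theorem continuous_gaugeEval (hα : Function.Surjective α) (c : CovariantPair B α)
    (a : StaceyCrossedProduct B α) : Continuous fun z => gaugeEval c z a := by
  refine continuous_of_uniform_approx_of_continuous fun u hu => ?_
  obtain ⟨ε, hε, hu⟩ := Metric.mem_uniformity_dist.1 hu
  obtain ⟨F, hF⟩ := exists_norm_sub_laurent_lt hα a hε
  refine ⟨fun z => gaugeEval c z (laurent hα F), ?_, fun z => hu ?_⟩
  · simp only [gaugeEval_laurent]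
    exact continuous_finsetSum _ fun n _ =>
      (continuous_subtype_val.comp (continuous_zpow n) :
        Continuous fun z : Circle => ((z ^ n : Circle) : ℂ)).smul continuous_const
  · rw [dist_eq_norm, ← map_sub]
    exact (norm_gaugeEval_le c z _).trans_lt hF

/-- The orbit of `a` under the gauge action, seen through the pair `c` and the functional `l`. -/
noncomputable def orbit (hα : Function.Surjective α) (c : CovariantPair B α)
    (l : StrongDual ℂ c.Carrier) (a : StaceyCrossedProduct B α) : C(UnitAddCircle, ℂ) :=
  ⟨fun x => l (gaugeEval c (AddCircle.toCircle x) a),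
    l.continuous.comp ((continuous_gaugeEval hα c a).comp AddCircle.continuous_toCircle)⟩

theorem norm_orbit_le (hα : Function.Surjective α) (c : CovariantPair B α)
    (l : StrongDual ℂ c.Carrier) (a : StaceyCrossedProduct B α) :
    ‖orbit hα c l a‖ ≤ ‖l‖ * ‖a‖ :=
  (ContinuousMap.norm_le _ (by positivity)).2 fun _ =>
    (l.le_opNorm _).trans (by gcongr; exact norm_gaugeEval_le c _ a)

theorem orbit_sub (hα : Function.Surjective α) (c : CovariantPair B α)
    (l : StrongDual ℂ c.Carrier) (a b : StaceyCrossedProduct B α) :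
    orbit hα c l (a - b) = orbit hα c l a - orbit hα c l b := by
  ext x
  simp [orbit]

theorem orbit_laurent (hα : Function.Surjective α) (c : CovariantPair B α)
    (l : StrongDual ℂ c.Carrier) (F : ℤ →₀ B) :
    orbit hα c l (laurent hα F) = ∑ n ∈ F.support,
      l (c.M (F n) * eval α c ((unitaryV hα ^ n : unitary _) : StaceyCrossedProduct B α)) •
        fourier n := by
  ext x
  simp [orbit, gaugeEval_laurent, AddCircle.toCircle_zsmul, mul_comm]

theorem fourierCoeff_orbit_laurent (hα : Function.Surjective α) (c : CovariantPair B α)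
    (l : StrongDual ℂ c.Carrier) (F : ℤ →₀ B) (n : ℤ) :
    fourierCoeff (orbit hα c l (laurent hα F)) n =
      l (c.M (F n) * eval α c ((unitaryV hα ^ n : unitary _) : StaceyCrossedProduct B α)) := by
  rw [orbit_laurent, ContinuousMap.coe_sum, fourierCoeff.sum _ _ fun i _ =>
    (ContinuousMap.continuous _).integrable_of_hasCompactSupport
      (HasCompactSupport.of_compactSpace _)]
  simp only [ContinuousMap.coe_smul, Finset.sum_apply, fourierCoeff.const_smul,
    fourierCoeff_fourier, Pi.single_apply, smul_eq_mul, mul_ite, mul_one, mul_zero,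
    Finset.sum_ite_eq, Finsupp.mem_support_iff]
  by_cases h : F n = 0 <;> simp [h]

theorem norm_fourierCoeff_le (f : C(UnitAddCircle, ℂ)) (n : ℤ) : ‖fourierCoeff f n‖ ≤ ‖f‖ := by
  have h := norm_integral_le_of_norm_le_const (μ := AddCircle.haarAddCircle (T := 1))
    (f := fun t : UnitAddCircle => fourier (-n) t • f t) (C := ‖f‖)
    (Filter.Eventually.of_forall fun t => by
      rw [norm_smul, fourier_apply, Circle.norm_coe, one_mul]
      exact f.norm_coe_le_norm t)
  simpa [fourierCoeff] using h

theorem norm_fourierCoeff_orbit_laurent_le (hα : Function.Surjective α) (c : CovariantPair B α)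
    (l : StrongDual ℂ c.Carrier) (F : ℤ →₀ B) (n : ℤ) :
    ‖fourierCoeff (orbit hα c l (laurent hα F)) n‖ ≤ ‖l‖ * ‖F n‖ := by
  rw [fourierCoeff_orbit_laurent]
  refine (l.le_opNorm _).trans ?_
  gcongr
  have h₁ : ‖c.M (F n)‖ ≤ ‖F n‖ := NonUnitalStarAlgHom.norm_apply_le c.M _
  have h₂ : ‖eval α c ((unitaryV hα ^ n : unitary _) : StaceyCrossedProduct B α)‖ = 1 :=
    CStarRing.norm_of_mem_unitary (Unitary.map_mem (eval α c) (unitaryV hα ^ n).2)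
  refine (norm_mul_le _ _).trans ?_
  rwa [h₂, mul_one]

theorem eq_zero_of_eval_eq_zero {a : StaceyCrossedProduct B α} (ha : ∀ c, eval α c a = 0) :
    a = 0 :=
  Subtype.ext (lp.ext (funext ha))

/-- The `n`-th coefficient is bounded by `‖l‖` times the norm of the element, and on a Laurent
polynomial by `‖l‖ * ‖F n‖`; both contributions can be made arbitrarily small. -/
theorem fourierCoeff_orbit_eq_zero (hα : Function.Surjective α) (c : CovariantPair B α)
    (l : StrongDual ℂ c.Carrier) {a : StaceyCrossedProduct B α} (n : ℤ)
    (ha : ∀ δ > 0, ∃ F, ‖a - laurent hα F‖ < δ ∧ ‖F n‖ ≤ δ) :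
    fourierCoeff (orbit hα c l a) n = 0 := by
  refine norm_le_zero_iff.1 (le_of_forall_pos_le_add fun ε hε => ?_)
  obtain ⟨δ, hδ, hδε⟩ : ∃ δ > 0, 2 * ‖l‖ * δ ≤ ε := by
    -- The `+ 1` keeps the denominator positive when `l = 0`.
    refine ⟨ε / (2 * ‖l‖ + 1), by positivity, ?_⟩
    rw [mul_div_assoc', div_le_iff₀ (by positivity)]
    nlinarith [norm_nonneg l]
  obtain ⟨F, hF, hFn⟩ := ha δ hδ
  have hsplit : orbit hα c l a =
      orbit hα c l (a - laurent hα F) + orbit hα c l (laurent hα F) := by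
    rw [orbit_sub, sub_add_cancel]
  have hint : ∀ f : C(UnitAddCircle, ℂ), Integrable f AddCircle.haarAddCircle := fun f =>
    f.continuous.integrable_of_hasCompactSupport (HasCompactSupport.of_compactSpace _)
  rw [hsplit, ContinuousMap.coe_add, fourierCoeff.add (hint _) (hint _), Pi.add_apply]
  calc _ ≤ ‖l‖ * ‖a - laurent hα F‖ + ‖l‖ * ‖F n‖ :=
        (norm_add_le _ _).trans (add_le_add
          ((norm_fourierCoeff_le _ n).trans (norm_orbit_le hα c l _))
          (norm_fourierCoeff_orbit_laurent_le hα c l F n))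
    _ ≤ ‖l‖ * δ + ‖l‖ * δ := by gcongr
    _ ≤ 0 + ε := by linarith

theorem eval_eq_zero_of_orbit_eq_zero (hα : Function.Surjective α) (c : CovariantPair B α)
    {a : StaceyCrossedProduct B α} (h : ∀ l, orbit hα c l a = 0) : eval α c a = 0 := by
  refine SeparatingDual.eq_zero_of_forall_dual_eq_zero (R := ℂ) fun l => ?_
  have h1 : orbit hα c l a 0 = l (eval α c a) := by
    simp [orbit, gaugeEval_one]
  rw [← h1, h, ContinuousMap.zero_apply]

/-- Vanishing coefficients are summable, so the Fourier series converges uniformly to `f`; its terms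
are all zero. -/
theorem _root_.ContinuousMap.eq_zero_of_fourierCoeff_eq_zero {f : C(UnitAddCircle, ℂ)}
    (h : ∀ n, fourierCoeff f n = 0) : f = 0 := by
  have hsummable : Summable (fourierCoeff f) := by
    rw [show fourierCoeff f = fun _ => (0 : ℂ) from funext h]
    exact summable_zero
  have hzero : (fun n => fourierCoeff f n • fourier n) = fun _ => (0 : C(UnitAddCircle, ℂ)) :=
    funext fun n => by
      ext x
      simp [h n]
  have hsum := hasSum_fourier_series_of_summable hsummable
  rw [hzero] at hsum
  exact hsum.unique hasSum_zero

/-- A star-homomorphism from the crossed product by a surjective endomorphism that dominates the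
coefficients of all Laurent polynomials is injective. -/
theorem injective_of_norm_coeff_le (hα : Function.Surjective α) {D : Type*} [CStarAlgebra D]
    (π : StaceyCrossedProduct B α →⋆ₐ[ℂ] D)
    (hπ : ∀ (F : ℤ →₀ B) (n : ℤ), ‖F n‖ ≤ ‖π (laurent hα F)‖) : Function.Injective π := by
  refine (injective_iff_map_eq_zero π).2 fun a ha => ?_
  refine eq_zero_of_eval_eq_zero fun c => eval_eq_zero_of_orbit_eq_zero hα c fun l => ?_
  refine ContinuousMap.eq_zero_of_fourierCoeff_eq_zero fun n => ?_
  refine fourierCoeff_orbit_eq_zero hα c l n fun δ hδ => ?_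
  obtain ⟨F, hF⟩ := exists_norm_sub_laurent_lt hα a hδ
  refine ⟨F, hF, ?_⟩
  -- As `π a = 0`, this bounds `‖π (laurent hα F)‖`, hence `‖F n‖`, by `δ`.
  have h : ‖π (a - laurent hα F)‖ ≤ ‖a - laurent hα F‖ := NonUnitalStarAlgHom.norm_apply_le π _
  rw [map_sub, ha, zero_sub, norm_neg] at h
  exact ((hπ F n).trans h).trans hF.le

end StaceyCrossedProduct

/-! ### Permutation and diagonal operators on `ℓ²`. -/

section SquareSummable

variable {ι X : Type*}

/-- A linear map given entrywise by `φ ↦ (i ↦ g i * φ (e i))` on `ℓ²`. -/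
noncomputable def lpWeightedShift (g : ι → ℂ) (e : ι ≃ ι) (C : ℝ) (hg : ∀ i, ‖g i‖ ≤ C) :
    lp (fun _ : ι => ℂ) 2 →L[ℂ] lp (fun _ : ι => ℂ) 2 :=
  have hmem : ∀ φ : lp (fun _ : ι => ℂ) 2, Memℓp (fun i => φ (e i)) 2 := fun φ =>
    (memℓp_gen_iff (by norm_num)).2
      (((memℓp_gen_iff (by norm_num)).1 (lp.memℓp φ)).comp_injective e.injective)
  have hle : ∀ (φ : lp (fun _ : ι => ℂ) 2) (i : ι),
      ‖g i * φ (e i)‖ ≤ ‖(C : ℂ) • φ (e i)‖ := fun φ i => by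
    rw [norm_mul, norm_smul, Complex.norm_real]
    gcongr
    exact (hg i).trans (le_abs_self C)
  LinearMap.mkContinuous
    { toFun := fun φ => ⟨fun i => g i * φ (e i), ((hmem φ).const_smul (C : ℂ)).mono' (hle φ)⟩
      map_add' := fun φ ψ => lp.ext (funext fun i => mul_add (g i) (φ (e i)) (ψ (e i)))
      map_smul' := fun c φ => by ext i; simp [mul_left_comm] }
    -- The absolute value is needed because `C` may be negative when `ι` is empty.
    |C| fun φ => by
      let ψ : lp (fun _ : ι => ℂ) 2 := ⟨fun i => φ (e i), hmem φ⟩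
      have hψ : ‖ψ‖ = ‖φ‖ := by
        rw [lp.norm_eq_tsum_rpow (by norm_num), lp.norm_eq_tsum_rpow (by norm_num),
          ← e.tsum_eq fun i => ‖φ i‖ ^ _]
      calc _ ≤ ‖(C : ℂ) • ψ‖ := lp.norm_mono (by norm_num) (hle φ)
        _ = |C| * ‖φ‖ := by rw [norm_smul, hψ, Complex.norm_real, Real.norm_eq_abs]

@[simp]
theorem lpWeightedShift_apply (g : ι → ℂ) (e : ι ≃ ι) (C : ℝ) (hg : ∀ i, ‖g i‖ ≤ C)
    (φ : lp (fun _ : ι => ℂ) 2) (i : ι) : lpWeightedShift g e C hg φ i = g i * φ (e i) :=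
  rfl

/-- The permutation operator `φ ↦ φ ∘ e` on `ℓ²`. -/
noncomputable def lpPermutation (e : ι ≃ ι) :
    lp (fun _ : ι => ℂ) 2 →L[ℂ] lp (fun _ : ι => ℂ) 2 :=
  lpWeightedShift 1 e 1 (by simp)

@[simp]
theorem lpPermutation_apply (e : ι ≃ ι) (φ : lp (fun _ : ι => ℂ) 2) (i : ι) :
    lpPermutation e φ i = φ (e i) := by
  simp [lpPermutation]

theorem star_lpPermutation (e : ι ≃ ι) : star (lpPermutation e) = lpPermutation e.symm := by
  rw [ContinuousLinearMap.star_eq_adjoint]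
  refine ((ContinuousLinearMap.eq_adjoint_iff _ _).2 fun φ ψ => ?_).symm
  rw [lp.inner_eq_tsum, lp.inner_eq_tsum, ← e.tsum_eq]
  simp

theorem star_lpPermutation_mul_self (e : ι ≃ ι) :
    star (lpPermutation e) * lpPermutation e = 1 := by
  rw [star_lpPermutation]
  ext φ i
  simp

variable [TopologicalSpace X] [CompactSpace X]

/-- The diagonal representation on `ℓ²` of the continuous functions on `X` along a family of
points of `X`. -/
noncomputable def lpDiagonal (x : ι → X) :
    C(X, ℂ) →⋆ₐ[ℂ] (lp (fun _ : ι => ℂ) 2 →L[ℂ] lp (fun _ : ι => ℂ) 2) where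
  toFun f := lpWeightedShift (fun i => f (x i)) (Equiv.refl ι) ‖f‖ fun i => f.norm_coe_le_norm _
  map_one' := by ext φ i; simp
  map_mul' f g := by ext φ i; simp [mul_assoc]
  map_zero' := by ext φ i; simp
  map_add' f g := by ext φ i; simp [add_mul]
  commutes' z := by ext φ i; simp [Algebra.algebraMap_eq_smul_one]
  map_star' f := by
    rw [ContinuousLinearMap.star_eq_adjoint]
    refine (ContinuousLinearMap.eq_adjoint_iff _ _).2 fun φ ψ => ?_
    rw [lp.inner_eq_tsum, lp.inner_eq_tsum]
    simp [mul_left_comm, mul_assoc]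

@[simp]
theorem lpDiagonal_apply (x : ι → X) (f : C(X, ℂ)) (φ : lp (fun _ : ι => ℂ) 2) (i : ι) :
    lpDiagonal x f φ i = f (x i) * φ i :=
  rfl

end SquareSummable

/-! ### The representation over `ℤ_p` and its coefficient bound. -/

section PadicRepresentation

variable {p : ℕ} [Fact p.Prime]

theorem padicAlpha_unit_surjective (r : ℤ_[p]ˣ) :
    Function.Surjective (padicAlpha (r : ℤ_[p]) r.ne_zero) := fun f =>
  ⟨f.comp ⟨fun x => r * x, by fun_prop⟩, by ext x; simp [padicAlpha_unit]⟩

/-- The point `r ^ k p ^ L γ(x)` of `ℤ_p` attached to the index `(k, L, x)`. -/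
noncomputable def padicPoint (r : ℤ_[p]ˣ) (γ : ℤ_[p]ˣ ⧸ padicG r → ℤ_[p]ˣ)
    (i : ℤ × ℕ × (ℤ_[p]ˣ ⧸ padicG r)) : ℤ_[p] :=
  ((r ^ i.1 : ℤ_[p]ˣ) : ℤ_[p]) * (p : ℤ_[p]) ^ i.2.1 * (γ i.2.2 : ℤ_[p])

/-- A closed subset of `ℤ_p` is everything if it contains the points `r ^ k p ^ L γ(x)`. -/
theorem mem_of_isClosed_of_padicPoint_mem {r : ℤ_[p]ˣ} {γ : ℤ_[p]ˣ ⧸ padicG r → ℤ_[p]ˣ}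
    (hγ : ∀ x : ℤ_[p]ˣ ⧸ padicG r, (γ x : ℤ_[p]ˣ ⧸ padicG r) = x) {s : Set ℤ_[p]}
    (hs : IsClosed s) (h : ∀ i, padicPoint r γ i ∈ s) (y : ℤ_[p]) : y ∈ s := by
  have hunit : ∀ (L : ℕ) (u : ℤ_[p]ˣ), (u : ℤ_[p]) * (p : ℤ_[p]) ^ L ∈ s := by
    intro L u
    -- The unit `u` differs from its representative by a limit of powers of `r`, and the condition
    -- on `g` below is closed and holds at those powers.
    have hg : (γ u)⁻¹ * u ∈ padicG r := QuotientGroup.eq.1 (hγ u)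
    have hcl : IsClosed {g : ℤ_[p]ˣ | (g : ℤ_[p]) * (p : ℤ_[p]) ^ L * (γ u : ℤ_[p]) ∈ s} :=
      hs.preimage (by fun_prop)
    have hsub : (Subgroup.zpowers r : Set ℤ_[p]ˣ) ⊆
        {g : ℤ_[p]ˣ | (g : ℤ_[p]) * (p : ℤ_[p]) ^ L * (γ u : ℤ_[p]) ∈ s} := by
      rintro _ ⟨k, rfl⟩
      exact h (k, L, u)
    have := closure_minimal hsub hcl hg
    rw [Set.mem_ofPred_eq, mul_right_comm, ← Units.val_mul, mul_right_comm, inv_mul_cancel,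
      one_mul] at this
    exact this
  by_cases hy : y = 0
  · subst hy
    have hp : ‖(p : ℤ_[p])‖ < 1 := by
      rw [PadicInt.norm_p]
      exact inv_lt_one_of_one_lt₀ (mod_cast (Fact.out : p.Prime).one_lt)
    -- Zero is not itself a unit times a power of `p`, but it is the limit of `p ^ L`.
    refine hs.mem_of_tendsto (tendsto_pow_atTop_nhds_zero_of_norm_lt_one hp)
      (Filter.Eventually.of_forall fun L => ?_)
    simpa using hunit L 1
  · rw [PadicInt.unitCoeff_spec hy]
    exact hunit _ _

/-- The shift `(k, L, x) ↦ (k - 1, L, x)` of the index set. -/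
def padicShift (Y : Type*) : ℤ × ℕ × Y ≃ ℤ × ℕ × Y :=
  (Equiv.subRight 1).prodCongr (Equiv.refl _)

/-- Lowering `k` by one multiplies the attached point by `r⁻¹`, which is how `α_r` acts on the
argument of `f`. -/
theorem padicShift_covariance (r : ℤ_[p]ˣ) (γ : ℤ_[p]ˣ ⧸ padicG r → ℤ_[p]ˣ) (f : C(ℤ_[p], ℂ)) :
    lpPermutation (padicShift _) * lpDiagonal (padicPoint r γ) f *
        star (lpPermutation (padicShift _)) =
      lpDiagonal (padicPoint r γ) (padicAlpha (r : ℤ_[p]) r.ne_zero f) := by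
  rw [star_lpPermutation]
  ext φ i
  have hpt : padicPoint r γ (padicShift _ i) = (r⁻¹ : ℤ_[p]ˣ) * padicPoint r γ i := by
    simp [padicPoint, padicShift, zpow_sub_one, mul_assoc, mul_left_comm]
  simp [padicAlpha_unit, hpt]

/-- Formulated for an arbitrary unitary equal to the shift, so that it applies to the image of
`unitaryV` under `π`. -/
theorem lpPermutation_padicShift_zpow (Y : Type*)
    (U : unitary (lp (fun _ : ℤ × ℕ × Y => ℂ) 2 →L[ℂ] lp (fun _ : ℤ × ℕ × Y => ℂ) 2))
    (hU : (U : lp (fun _ : ℤ × ℕ × Y => ℂ) 2 →L[ℂ] lp (fun _ : ℤ × ℕ × Y => ℂ) 2) =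
      lpPermutation (padicShift Y)) (n : ℤ) (φ : lp (fun _ : ℤ × ℕ × Y => ℂ) 2)
    (k : ℤ) (y : ℕ × Y) :
    ((U ^ n : unitary _) : lp (fun _ : ℤ × ℕ × Y => ℂ) 2 →L[ℂ] lp (fun _ : ℤ × ℕ × Y => ℂ) 2)
      φ (k, y) = φ (k - n, y) := by
  induction n generalizing φ with
  | zero => simp
  | succ n ih =>
    rw [zpow_add_one, Submonoid.coe_mul, mul_apply_eq_comp, ih, hU,
      lpPermutation_apply]
    simp [padicShift, sub_sub]
  | pred n ih =>
    rw [zpow_sub_one, Submonoid.coe_mul, ← Unitary.star_eq_inv, Unitary.coe_star,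
      mul_apply_eq_comp, ih, hU, star_lpPermutation, lpPermutation_apply]
    have h : k - (-(n : ℤ) - 1) = k + (n + 1) := by ring
    simp [padicShift, add_assoc, h]

open StaceyCrossedProduct in
theorem norm_le_norm_map_laurent {r : ℤ_[p]ˣ} {γ : ℤ_[p]ˣ ⧸ padicG r → ℤ_[p]ˣ}
    (hγ : ∀ x : ℤ_[p]ˣ ⧸ padicG r, (γ x : ℤ_[p]ˣ ⧸ padicG r) = x)
    {π : PadicCrossedProduct (r : ℤ_[p]) r.ne_zero →⋆ₐ[ℂ] (padicSpace r →L[ℂ] padicSpace r)}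
    (hV : π (V (padicAlpha (r : ℤ_[p]) r.ne_zero)) = lpPermutation (padicShift _))
    (hM : ∀ f, π (M (padicAlpha (r : ℤ_[p]) r.ne_zero) f) = lpDiagonal (padicPoint r γ) f)
    (F : ℤ →₀ C(ℤ_[p], ℂ)) (n : ℤ) :
    ‖F n‖ ≤ ‖π (laurent (padicAlpha_unit_surjective r) F)‖ := by
  classical
  set W := unitaryV (padicAlpha_unit_surjective r)
  have hW : ∀ (m : ℤ) (φ : padicSpace r) k y,
      π ((W ^ m : unitary _) : PadicCrossedProduct (r : ℤ_[p]) r.ne_zero) φ (k, y) =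
        φ (k - m, y) := by
    intro m φ k y
    rw [← lpPermutation_padicShift_zpow _ (Unitary.map (StarMonoidHom.ofClass π) W) hV m φ k y, ← map_zpow]
    rfl
  refine (ContinuousMap.norm_le _ (norm_nonneg _)).2 fun y => ?_
  refine mem_of_isClosed_of_padicPoint_mem hγ
    (s := {y | ‖F n y‖ ≤ ‖π (laurent (padicAlpha_unit_surjective r) F)‖})
    (isClosed_le (by fun_prop) continuous_const) ?_ y
  rintro ⟨k, i⟩
  -- `V ^ n` carries this basis vector to the one at `(k, i)`, while every other power of `V`
  -- carries it elsewhere; the `(k, i)` entry thus isolates `F n`.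
  let e : padicSpace r := lp.single 2 (k - n, i) 1
  have he : ‖e‖ = 1 := by simp [e, lp.norm_single]
  have hval : π (laurent (padicAlpha_unit_surjective r) F) e (k, i) =
      F n (padicPoint r γ (k, i)) := by
    have hterm : ∀ m, π (M (padicAlpha (r : ℤ_[p]) r.ne_zero) (F m) * (W ^ m : unitary _)) e (k, i) =
        if m = n then F n (padicPoint r γ (k, i)) else 0 := by
      intro m
      rw [map_mul, mul_apply_eq_comp, hM, lpDiagonal_apply, hW]
      split_ifs with h
      · subst h
        simp [e]
      · rw [lp.single_apply_ne, mul_zero]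
        simpa using h
    rw [laurent, Finsupp.sum, map_sum, sum_apply, lp.coeFn_sum,
      Finset.sum_apply, Finset.sum_congr rfl fun m _ => hterm m, Finset.sum_ite_eq']
    split_ifs with h
    · rfl
    · rw [Finsupp.notMem_support_iff.1 h, ContinuousMap.zero_apply]
  rw [Set.mem_ofPred_eq, ← hval]
  calc _ ≤ ‖π (laurent (padicAlpha_unit_surjective r) F) e‖ :=
        lp.norm_apply_le_norm (by norm_num) _ _
    _ ≤ ‖π (laurent (padicAlpha_unit_surjective r) F)‖ * ‖e‖ :=
        ContinuousLinearMap.le_opNorm _ _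
    _ = _ := by rw [he, mul_one]

end PadicRepresentation

theorem mainTheorem3 (p : ℕ) [Fact p.Prime] (r : ℤ_[p]ˣ) (hr : ∀ n : ℕ, 0 < n → r ^ n ≠ 1)
    (γ : ℤ_[p]ˣ ⧸ padicG r → ℤ_[p]ˣ)
    (hγ : ∀ x : ℤ_[p]ˣ ⧸ padicG r, (γ x : ℤ_[p]ˣ ⧸ padicG r) = x) :
    ∃ π : PadicCrossedProduct (r : ℤ_[p]) r.ne_zero →⋆ₐ[ℂ] (padicSpace r →L[ℂ] padicSpace r),
      (∀ (φ : padicSpace r) (k : ℤ) (L : ℕ) (x : ℤ_[p]ˣ ⧸ padicG r),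
        π (StaceyCrossedProduct.V (padicAlpha (r : ℤ_[p]) r.ne_zero)) φ (k, L, x) =
          φ (k - 1, L, x)) ∧
      (∀ (f : C(ℤ_[p], ℂ)) (φ : padicSpace r) (k : ℤ) (L : ℕ) (x : ℤ_[p]ˣ ⧸ padicG r),
        π (StaceyCrossedProduct.M (padicAlpha (r : ℤ_[p]) r.ne_zero) f) φ (k, L, x) =
          f (((r ^ k : ℤ_[p]ˣ) : ℤ_[p]) * (p : ℤ_[p]) ^ L * (γ x : ℤ_[p])) * φ (k, L, x)) ∧
      Function.Injective π := by
  obtain ⟨π, ⟨hV, hM⟩, -⟩ := StaceyCrossedProduct.existsUnique_lift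
    (padicAlpha (r : ℤ_[p]) r.ne_zero) (lpDiagonal (padicPoint r γ))
    (lpPermutation (padicShift _)) (star_lpPermutation_mul_self _) (padicShift_covariance r γ)
  refine ⟨π, fun φ k L x => ?_, fun f φ k L x => ?_,
    StaceyCrossedProduct.injective_of_norm_coeff_le (padicAlpha_unit_surjective r) π
      (norm_le_norm_map_laurent hγ hV hM)⟩
  · rw [hV]
    simp [padicShift]
  · rw [hM]
    rfl
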